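/- **Setting.** Consider a multi-objective Markov decision process with measurable state space $\mathcal S$, standard Borel action space $\mathcal A$, transition kernel $\mathcal P(\cdot\mid s,a)$, initial state distribution, measurable reward functions $\mathcal R_1,\dots,\mathcal R_n:\mathcal S\times\mathcal A\to\mathbb R$, horizon $T\in\{0,1,2,\dots\}\cup\{\infty\}$ and discount factor $\gamma\in[0,1]$, with $\gamma<1$ if $T=\infty$. A policy $\pi$ is a randomized Markov policy $\pi(\cdot\mid s)$, that is, a probability kernel from $\mathcal S$ to $\mathcal A$; it is stationary if $T=\infty$, and may depend on the time step if $T<\infty$. Its expected returns are $$G_i^\pi=\mathbb E^\pi\Big[\sum_{0\le k<T}\gamma^k\,\mathcal R_i(s_k,a_k)\Big],\qquad i=1,\dots,n .$$ Fix an objective $l$ and thresholds $d_i\in\mathbb R$, $i\ne l$. The constrained problem, with optimal value $P^*$, and its Lagrangian dual, with optimal value $D^*$, are $$P^*=\sup_\pi\{G_l^\pi : G_i^\pi\ge d_i \text{ for all } i\ne l\},\qquad D^*=\inf_{\lambda\ge 0}\ \sup_\pi\Big(G_l^\pi-\sum_{i\ne l}\lambda_i\,(d_i-G_i^\pi)\Big).$$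 **Theorem.** Suppose that every $\mathcal R_i$ is bounded and that Slater's condition holds: some policy $\pi$ satisfies $G_i^\pi>d_i$ for all $i\ne l$. 1. Strong duality holds: $P^*=D^*$. Moreover, the infimum over $\lambda\ge 0$ that defines $D^*$ is attained. 2. Suppose that $d_i=\beta G_i^{\pi_r}$ for all $i\neq l$, for some $\beta\in\mathbb R$ and some policy $\pi_r$, and let $t>0$. Consider the log-barrier problem of maximising $$F_t(\pi)=G_l^\pi+\sum_{i\ne l}\frac{\log\big(G_i^\pi-\beta G_i^{\pi_r}\big)}{t}$$ over the strictly feasible policies, i.e. those with $G_i^\pi>\beta G_i^{\pi_r}$ for all $i\ne l$. * Every maximiser $\pi$ of the log-barrier problem is feasible for the constrained problem and satisfies $$P^*-G_l^{\pi}\le\frac{n-1}{t}.$$ * Whether or not a maximiser exists, for every $\eta>0$ there is an $\varepsilon>0$ such that every strictly feasible policy $\pi$ with $F_t(\pi)\ge F_t(\pi')-\varepsilon$ for all strictly feasible $\pi'$ satisfies $P^*-G_l^\pi\le\frac{n-1}{t}+\eta$. -/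

import Mathlib

open MeasureTheory ProbabilityTheory

/-- A multi-objective Markov decision process with state space `S`, action space `A` and `n`
reward functions. The horizon is the number of time steps that are counted; it may be infinite,
in which case the discount factor has to be smaller than one. -/
structure MOMDP (S A : Type*) [MeasurableSpace S] [MeasurableSpace A] (n : ℕ) where
  /-- The law of the initial state. -/
  init : Measure S
  init_prob : IsProbabilityMeasure init
  /-- The transition probabilities. -/
  transition : Kernel (S × A) S
  transition_markov : IsMarkovKernel transition
  /-- The reward functions, one for each objective. -/
  reward : Fin n → S × A → ℝ
  reward_measurable : ∀ i, Measurable (reward i)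
  /-- The discount factor. -/
  discount : ℝ
  discount_nonneg : 0 ≤ discount
  discount_le_one : discount ≤ 1
  /-- The time horizon. -/
  horizon : ℕ∞
  discount_lt_one : horizon = ⊤ → discount < 1

namespace MOMDP

attribute [instance] MOMDP.init_prob MOMDP.transition_markov

section

variable {S A : Type*} [MeasurableSpace S] [MeasurableSpace A] {n : ℕ}

/-- A randomized Markov policy: at time `t` in the state `s` the action has law `kernel t s`.
If the horizon is infinite, then policies are stationary; if it is finite, then they may depend
on the time step. -/
structure Policy (M : MOMDP S A n) where
  /-- The law of the action, given the time and the state. -/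
  kernel : ℕ → Kernel S A
  markov : ∀ t, IsMarkovKernel (kernel t)
  stationary : M.horizon = ⊤ → ∀ t, kernel t = kernel 0

attribute [instance] Policy.markov

/-- The law of the state-action pair at time `k + 1`, given the state-action pairs up to time `k`:
the state is drawn from the transition kernel at the last pair, and then the action is drawn from
the policy at that state. -/
noncomputable def stepKernel (M : MOMDP S A n) (π : M.Policy) (k : ℕ) :
    Kernel ((_ : Finset.Iic k) → S × A) (S × A) :=
  (M.transition ⊗ₖ Kernel.prodMkLeft (S × A) (π.kernel (k + 1))).comap
    (fun h => h ⟨k, Finset.mem_Iic.2 le_rfl⟩) (measurable_pi_apply _)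

instance (M : MOMDP S A n) (π : M.Policy) (k : ℕ) : IsMarkovKernel (M.stepKernel π k) := by
  unfold stepKernel
  infer_instance

/-- The law of the trajectory `(s₀, a₀), (s₁, a₁), …` under a policy. -/
noncomputable def trajectoryLaw (M : MOMDP S A n) (π : M.Policy) : Measure (ℕ → S × A) :=
  Kernel.trajMeasure (X := fun _ => S × A) (M.init ⊗ₘ π.kernel 0) (M.stepKernel π)

/-- The expected return `G_i^π`, the expectation of the discounted sum of the rewards of the
objective `i` over the time steps `t = 0, 1, …` before the horizon. -/
noncomputable def expectedReturn (M : MOMDP S A n) (i : Fin n) (π : M.Policy) : ℝ :=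
  open Classical in
  ∫ ω, ∑' t : ℕ, (if (t : ℕ∞) < M.horizon then M.discount ^ t * M.reward i (ω t) else 0)
    ∂(M.trajectoryLaw π)

/-- The policy satisfies the constraints `G_i^π ≥ d_i` for `i ≠ l`. -/
def Feasible (M : MOMDP S A n) (l : Fin n) (d : {i : Fin n // i ≠ l} → ℝ) (π : M.Policy) : Prop :=
  ∀ i : {i : Fin n // i ≠ l}, d i ≤ M.expectedReturn i π

/-- The policy satisfies the constraints strictly, `G_i^π > d_i` for `i ≠ l`. -/
def StrictlyFeasible (M : MOMDP S A n) (l : Fin n) (d : {i : Fin n // i ≠ l} → ℝ)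
    (π : M.Policy) : Prop :=
  ∀ i : {i : Fin n // i ≠ l}, d i < M.expectedReturn i π

/-- Slater's condition: some policy is strictly feasible. -/
def Slater (M : MOMDP S A n) (l : Fin n) (d : {i : Fin n // i ≠ l} → ℝ) : Prop :=
  ∃ π : M.Policy, M.StrictlyFeasible l d π

/-- The optimal value `P*` of the constrained problem: the supremum of `G_l^π` over all policies
with `G_i^π ≥ d_i` for `i ≠ l`. -/
noncomputable def primalValue (M : MOMDP S A n) (l : Fin n) (d : {i : Fin n // i ≠ l} → ℝ) :
    EReal :=
  ⨆ (π : M.Policy) (_ : M.Feasible l d π), (M.expectedReturn l π : EReal)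

/-- The Lagrangian `L(lam, π) = G_l^π - ∑_{i ≠ l} lam_i (d_i - G_i^π)`. -/
noncomputable def lagrangian (M : MOMDP S A n) (l : Fin n) (d : {i : Fin n // i ≠ l} → ℝ)
    (lam : {i : Fin n // i ≠ l} → ℝ) (π : M.Policy) : ℝ :=
  M.expectedReturn l π - ∑ i : {i : Fin n // i ≠ l}, lam i * (d i - M.expectedReturn i π)

/-- The dual function, the supremum of the Lagrangian over all policies. -/
noncomputable def dualFunction (M : MOMDP S A n) (l : Fin n) (d : {i : Fin n // i ≠ l} → ℝ)
    (lam : {i : Fin n // i ≠ l} → ℝ) : EReal :=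
  ⨆ π : M.Policy, (M.lagrangian l d lam π : EReal)

/-- The dual value `D*`: the infimum of the dual function over all nonnegative multipliers. -/
noncomputable def dualValue (M : MOMDP S A n) (l : Fin n) (d : {i : Fin n // i ≠ l} → ℝ) : EReal :=
  ⨅ (lam : {i : Fin n // i ≠ l} → ℝ) (_ : 0 ≤ lam), M.dualFunction l d lam

/-- The objective of the interior point method,
`G_l^π + ∑_{i ≠ l} log (G_i^π - β G_i^{π_r}) / t`. It is meaningful for policies with
`G_i^π > β G_i^{π_r}` for `i ≠ l`, and is used for them only. -/
noncomputable def barrierObjective (M : MOMDP S A n) (l : Fin n) (β : ℝ) (πr : M.Policy) (t : ℝ)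
    (π : M.Policy) : ℝ :=
  M.expectedReturn l π + ∑ i : {i : Fin n // i ≠ l},
    Real.log (M.expectedReturn i π - β * M.expectedReturn i πr) / t

/-- The policy solves the log-barrier problem up to an error `ε`: it lies in the domain
`G_i^π > β G_i^{π_r}`, `i ≠ l`, of the barrier, and no policy in that domain has a barrier objective
that is larger by more than `ε`. For `ε = 0` it is a maximiser. -/
def IsBarrierSolution (M : MOMDP S A n) (l : Fin n) (β : ℝ) (πr : M.Policy) (t ε : ℝ)
    (π : M.Policy) : Prop :=
  M.StrictlyFeasible l (fun i => β * M.expectedReturn i πr) π ∧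
    ∀ π' : M.Policy, M.StrictlyFeasible l (fun i => β * M.expectedReturn i πr) π' →
      M.barrierObjective l β πr t π' ≤ M.barrierObjective l β πr t π + ε

end

end MOMDP

/-!
The expected returns are linear in the (unnormalised, discounted) occupancy measure
`∑ t, γ ^ t • law (s_t, a_t)` of a policy, and the set of occupancy measures is convex
(`MOMDP.exists_policy_occupancy_eq`). To realise a mixture of two of them, disintegrate: for a
finite horizon, the mixture of the marginal laws at each time, which gives a time-dependent policy
with these marginals; for an infinite horizon, the mixture of the occupancy measures itself, which
gives a stationary policy. In the latter case the mixture satisfies the discounted flow equation of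
that policy, whose only finite solution is the occupancy measure
(`MOMDP.eq_occupancy_of_flow`). Hence the set of attainable return vectors is convex, although the
returns are not concave functions of the policy.

Strong duality is then finite-dimensional: separating the convex set of return vectors from the
open orthant of vectors that beat the optimal value and the thresholds gives nonnegative
coefficients, and Slater's condition makes the coefficient of the objective `l` positive, so that
the others can be normalised to optimal multipliers (`Convex.exists_lagrange_multiplier`).

For the log-barrier problem, take a policy whose return vector is `1 - θ` times that of an
approximate solution plus `θ` times that of a feasible competitor. Each slack shrinks by a factor
of at least `1 - θ`, so each of the `n - 1` barrier terms drops by at most `θ / ((1 - θ) t)`, while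
the objective gains `θ` times the gap (`MOMDP.IsBarrierSolution.expectedReturn_le`). Dividing by
`θ` and letting `θ` tend to zero bounds the gap by `(n - 1) / t`; a fixed small `θ` gives the
statement for approximate solutions.
-/

open scoped ENNReal

namespace MOMDP

section Occupancy

variable {S A : Type*} [MeasurableSpace S] [MeasurableSpace A] {n : ℕ}

/-! ### Marginal laws of the trajectory -/

/-- The law of the state-action pair at time `k` under a policy. -/
noncomputable def pairLaw (M : MOMDP S A n) (π : M.Policy) (k : ℕ) : Measure (S × A) :=
  (M.trajectoryLaw π).map (fun ω => ω k)

instance (M : MOMDP S A n) (π : M.Policy) : IsProbabilityMeasure (M.trajectoryLaw π) := by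
  unfold trajectoryLaw; infer_instance

instance (M : MOMDP S A n) (π : M.Policy) (k : ℕ) : IsProbabilityMeasure (M.pairLaw π k) :=
  Measure.isProbabilityMeasure_map (measurable_pi_apply k).aemeasurable

/-- The one-step transition kernel on state-action pairs: the next state is drawn from the
transition kernel and the next action from the kernel `κ`. -/
noncomputable def pairKernel (M : MOMDP S A n) (κ : Kernel S A) : Kernel (S × A) (S × A) :=
  M.transition ⊗ₖ Kernel.prodMkLeft (S × A) κ

instance (M : MOMDP S A n) (κ : Kernel S A) [IsMarkovKernel κ] :
    IsMarkovKernel (M.pairKernel κ) := by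
  unfold pairKernel; infer_instance

theorem pairKernel_comp (M : MOMDP S A n) (κ : Kernel S A) [IsMarkovKernel κ]
    (μ : Measure (S × A)) [SFinite μ] :
    M.pairKernel κ ∘ₘ μ = (M.transition ∘ₘ μ) ⊗ₘ κ := by
  ext s hs
  have hm : Measurable fun x => κ x (Prod.mk x ⁻¹' s) := Kernel.measurable_kernel_prodMk_left hs
  rw [Measure.bind_apply hs (Kernel.aemeasurable _), Measure.compProd_apply hs,
    Measure.lintegral_bind (Kernel.aemeasurable _) hm.aemeasurable]
  refine lintegral_congr fun ω => ?_
  rw [pairKernel, Kernel.compProd_apply hs]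
  rfl

theorem pairLaw_zero (M : MOMDP S A n) (π : M.Policy) :
    M.pairLaw π 0 = M.init ⊗ₘ π.kernel 0 := by
  have h1 : (fun ω : ℕ → S × A => ω 0) =
      (fun x => x ⟨0, Finset.mem_Iic.2 le_rfl⟩) ∘ Preorder.frestrictLe (π := fun _ => S × A) 0 := rfl
  unfold pairLaw trajectoryLaw Kernel.trajMeasure
  rw [h1, ← Measure.map_map (by fun_prop) (by fun_prop), Measure.map_comp _ _ (by fun_prop),
    Kernel.traj_map_frestrictLe, Kernel.partialTraj_self, Measure.id_comp,
    Measure.map_map (by fun_prop) (by fun_prop)]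
  exact Measure.map_id

theorem pairLaw_succ (M : MOMDP S A n) (π : M.Policy) (k : ℕ) :
    M.pairLaw π (k + 1) = M.pairKernel (π.kernel (k + 1)) ∘ₘ M.pairLaw π k := by
  have h := congrArg Measure.snd <| Kernel.map_frestrictLe_trajMeasure_compProd_eq_map_trajMeasure
    (μ₀ := M.init ⊗ₘ π.kernel 0) (X := fun _ => S × A) (κ := M.stepKernel π) (a := k)
  rw [Measure.snd_compProd, Measure.snd, Measure.map_map (by fun_prop) (by fun_prop)] at h
  change _ = M.pairLaw π (k + 1) at h
  rw [← h]
  ext s hs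
  have hm : Measurable fun x => M.pairKernel (π.kernel (k + 1)) x s := Kernel.measurable_coe _ hs
  rw [Measure.bind_apply hs (Kernel.aemeasurable _),
    lintegral_map (Kernel.measurable_coe _ hs) (by fun_prop),
    Measure.bind_apply hs (Kernel.aemeasurable _), pairLaw,
    lintegral_map hm (by fun_prop)]
  rfl

/-! ### Occupancy measures -/

open Classical in
/-- The weight of the time step `t` in the return: `γ ^ t` before the horizon and `0`
from the horizon on. -/
noncomputable def weight (M : MOMDP S A n) (t : ℕ) : ℝ :=
  if (t : ℕ∞) < M.horizon then M.discount ^ t else 0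

theorem weight_nonneg (M : MOMDP S A n) (t : ℕ) : 0 ≤ M.weight t := by
  unfold weight
  split_ifs
  · exact pow_nonneg M.discount_nonneg t
  · exact le_rfl

theorem weight_of_horizon_eq_top (M : MOMDP S A n) (h : M.horizon = ⊤) (t : ℕ) :
    M.weight t = M.discount ^ t := by
  simp [weight, h]

theorem summable_weight (M : MOMDP S A n) : Summable M.weight := by
  by_cases h : M.horizon = ⊤
  · rw [funext (M.weight_of_horizon_eq_top h)]
    exact summable_geometric_of_lt_one M.discount_nonneg (M.discount_lt_one h)
  · obtain ⟨N, hN⟩ := ENat.ne_top_iff_exists.1 h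
    refine summable_of_ne_finset_zero (s := Finset.range N) fun t ht => ?_
    rw [weight, ← hN, if_neg]
    simpa using ht

/-- The occupancy measure of a policy, the sum of the laws of the state-action pairs at all times
before the horizon, with discounted weights. It is not normalised. -/
noncomputable def occupancy (M : MOMDP S A n) (π : M.Policy) : Measure (S × A) :=
  Measure.sum fun t => ENNReal.ofReal (M.weight t) • M.pairLaw π t

theorem occupancy_univ (M : MOMDP S A n) (π : M.Policy) :
    M.occupancy π Set.univ = ENNReal.ofReal (∑' t, M.weight t) := by
  rw [occupancy, Measure.sum_apply _ .univ,
    ENNReal.ofReal_tsum_of_nonneg M.weight_nonneg M.summable_weight]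
  simp

instance (M : MOMDP S A n) (π : M.Policy) : IsFiniteMeasure (M.occupancy π) :=
  ⟨by rw [occupancy_univ]; exact ENNReal.ofReal_lt_top⟩

/-- Bounded rewards can be integrated term by term, so that the expected return is linear in the
occupancy measure. -/
theorem expectedReturn_eq_integral_occupancy (M : MOMDP S A n) (i : Fin n)
    {B : ℝ} (hB : ∀ x, |M.reward i x| ≤ B) (π : M.Policy) :
    M.expectedReturn i π = ∫ x, M.reward i x ∂M.occupancy π := by
  have hint (μ : Measure (S × A)) [IsFiniteMeasure μ] : Integrable (M.reward i) μ :=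
    .of_bound (M.reward_measurable i).aestronglyMeasurable B (.of_forall hB)
  have hint' (t : ℕ) : Integrable (fun ω => M.weight t * M.reward i (ω t)) (M.trajectoryLaw π) :=
    ((hint (M.pairLaw π t)).comp_measurable (measurable_pi_apply t)).const_mul _
  have hsum : Summable fun t =>
      ∫ ω, ‖M.weight t * M.reward i (ω t)‖ ∂M.trajectoryLaw π := by
    refine .of_nonneg_of_le (fun t => integral_nonneg fun _ => norm_nonneg _) (fun t => ?_)
      (M.summable_weight.mul_right B)
    calc ∫ ω, ‖M.weight t * M.reward i (ω t)‖ ∂M.trajectoryLaw π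
        ≤ ∫ _, M.weight t * B ∂M.trajectoryLaw π := by
          refine integral_mono (hint' t).norm (integrable_const _) fun ω => ?_
          simp only [norm_mul, Real.norm_eq_abs, abs_of_nonneg (M.weight_nonneg t)]
          exact mul_le_mul_of_nonneg_left (hB _) (M.weight_nonneg t)
      _ = M.weight t * B := by simp
  have h1 : M.expectedReturn i π =
      ∫ ω, ∑' t, M.weight t * M.reward i (ω t) ∂M.trajectoryLaw π := by
    simp only [expectedReturn, weight, ite_mul, zero_mul]
  rw [h1, ← (hasSum_integral_of_summable_integral_norm hint' hsum).tsum_eq, occupancy,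
    integral_sum_measure (hint (M.occupancy π))]
  refine tsum_congr fun t => ?_
  rw [integral_const_mul, integral_smul_measure, ENNReal.toReal_ofReal (M.weight_nonneg t),
    smul_eq_mul, pairLaw, integral_map (measurable_pi_apply t).aemeasurable
      (M.reward_measurable i).aestronglyMeasurable]

/-! ### Convexity of the set of occupancy measures -/

/-- For a finite horizon, disintegrating the mixture of the marginal laws at every time yields a
policy whose marginal laws are these mixtures. -/
theorem exists_policy_pairLaw_eq [StandardBorelSpace A] (M : MOMDP S A n)
    (hfin : M.horizon ≠ ⊤) (π₁ π₂ : M.Policy) {a b : ℝ≥0∞} (hab : a + b = 1) :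
    ∃ π : M.Policy, ∀ t, M.pairLaw π t = a • M.pairLaw π₁ t + b • M.pairLaw π₂ t := by
  have hne : Nonempty A := (nonempty_of_isProbabilityMeasure (M.pairLaw π₁ 0)).map Prod.snd
  let ρ (t : ℕ) : Measure (S × A) := a • M.pairLaw π₁ t + b • M.pairLaw π₂ t
  have hρ (t : ℕ) : IsProbabilityMeasure (ρ t) := ⟨by simp [ρ, hab]⟩
  let π : M.Policy :=
    { kernel := fun t => (ρ t).condKernel
      markov := fun t => inferInstance
      stationary := fun h => absurd h hfin }
  have hρ_eq (t : ℕ) : (ρ t).fst ⊗ₘ π.kernel t = ρ t := (ρ t).disintegrate _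
  have hfst (μ ν : Measure (S × A)) : (a • μ + b • ν).fst = a • μ.fst + b • ν.fst := by
    simp [Measure.fst, Measure.map_add _ _ measurable_fst]
  refine ⟨π, fun t => ?_⟩
  change _ = ρ t
  induction t with
  | zero =>
    rw [← hρ_eq 0, pairLaw_zero]
    congr 1
    rw [hfst, pairLaw_zero, pairLaw_zero, Measure.fst_compProd, Measure.fst_compProd, ← add_smul,
      hab, one_smul]
  | succ t ih =>
    rw [← hρ_eq (t + 1), pairLaw_succ, ih, pairKernel_comp]
    congr 1
    rw [hfst, pairLaw_succ, pairLaw_succ, pairKernel_comp, pairKernel_comp,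
      Measure.fst_compProd, Measure.fst_compProd, Measure.comp_add, Measure.comp_smul,
      Measure.comp_smul]

/-- For an infinite horizon, the state marginal of an occupancy measure satisfies the discounted
flow equation. -/
theorem fst_occupancy (M : MOMDP S A n) (h : M.horizon = ⊤) (π : M.Policy) :
    (M.occupancy π).fst =
      M.init + ENNReal.ofReal M.discount • (M.transition ∘ₘ M.occupancy π) := by
  have hw (t : ℕ) : ENNReal.ofReal (M.weight t) = ENNReal.ofReal M.discount ^ t := by
    rw [M.weight_of_horizon_eq_top h, ENNReal.ofReal_pow M.discount_nonneg]
  have h0 : (M.pairLaw π 0).fst = M.init := by rw [pairLaw_zero, Measure.fst_compProd]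
  have hs (t : ℕ) : (M.pairLaw π (t + 1)).fst = M.transition ∘ₘ M.pairLaw π t := by
    rw [pairLaw_succ, pairKernel_comp, Measure.fst_compProd]
  rw [occupancy, Measure.bind_sum _ _ (Kernel.aemeasurable _), Measure.fst,
    Measure.map_sum measurable_fst.aemeasurable]
  ext s hs'
  simp only [hw, Measure.map_smul, Measure.comp_smul, Measure.add_apply, Measure.smul_apply,
    smul_eq_mul, Measure.sum_apply _ hs']
  rw [tsum_eq_zero_add' ENNReal.summable, ← ENNReal.tsum_mul_left]
  change _ * (M.pairLaw π 0).fst s + ∑' t, _ * (M.pairLaw π (t + 1)).fst s = _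
  simp only [h0, hs, pow_zero, one_mul, pow_succ', mul_assoc]

/-- For an infinite horizon, the discounted flow equation determines the occupancy measure: its
iteration expands a solution into the discounted sum of the marginal laws, with a remainder that
tends to zero geometrically. -/
theorem eq_occupancy_of_flow (M : MOMDP S A n) (h : M.horizon = ⊤) (π : M.Policy)
    (ρ : Measure (S × A)) [IsFiniteMeasure ρ]
    (hflow : ρ.fst = M.init + ENNReal.ofReal M.discount • (M.transition ∘ₘ ρ))
    (hdis : ρ.fst ⊗ₘ π.kernel 0 = ρ) : ρ = M.occupancy π := by
  set γ := ENNReal.ofReal M.discount with hγ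
  have hγ1 : γ < 1 := by
    rw [hγ, ENNReal.ofReal_lt_one]
    exact M.discount_lt_one h
  let K := M.pairKernel (π.kernel 0)
  have hK (t : ℕ) : K ∘ₘ M.pairLaw π t = M.pairLaw π (t + 1) := by
    rw [pairLaw_succ, π.stationary h (t + 1)]
  have hfix : ρ = M.pairLaw π 0 + γ • (K ∘ₘ ρ) := by
    have : IsFiniteMeasure (γ • (M.transition ∘ₘ ρ)) :=
      Measure.smul_finite _ (hγ1.trans ENNReal.one_lt_top).ne
    conv_lhs => rw [← hdis, hflow, Measure.compProd_add_left, ← pairLaw_zero,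
      Measure.compProd_smul_left, ← pairKernel_comp]
  let R (t : ℕ) : Measure (S × A) := (fun μ => K ∘ₘ μ)^[t] ρ
  have hR_succ (t : ℕ) : R (t + 1) = K ∘ₘ R t := Function.iterate_succ_apply' _ _ _
  have hR (t : ℕ) : R t = M.pairLaw π t + γ • R (t + 1) := by
    induction t with
    | zero => exact hfix
    | succ t ih => rw [hR_succ (t + 1), ← hK, ← Measure.comp_smul, ← Measure.comp_add, ← ih,
        hR_succ]
  have hR_univ (t : ℕ) : R t Set.univ = ρ Set.univ := by
    induction t with
    | zero => rfl
    | succ t ih => rw [hR_succ, Measure.comp_apply_univ, ih]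
  ext s hs
  have hsum (N : ℕ) :
      ρ s = ∑ t ∈ Finset.range N, γ ^ t * M.pairLaw π t s + γ ^ N * R N s := by
    induction N with
    | zero => simp [R]
    | succ N ih =>
      rw [ih, Finset.sum_range_succ, hR N]
      simp only [Measure.add_apply, Measure.smul_apply, smul_eq_mul]
      ring
  have hrem : Filter.Tendsto (fun N => γ ^ N * R N s) Filter.atTop (nhds 0) := by
    have := ENNReal.Tendsto.mul_const (ENNReal.tendsto_pow_atTop_nhds_zero_of_lt_one hγ1)
      (b := ρ Set.univ) (Or.inr (measure_ne_top ρ _))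
    rw [zero_mul] at this
    refine tendsto_of_tendsto_of_tendsto_of_le_of_le tendsto_const_nhds this
      (fun _ => zero_le) fun N => ?_
    exact mul_le_mul_right ((measure_mono (Set.subset_univ s)).trans (hR_univ N).le) _
  have hlim := (ENNReal.summable (f := fun t => γ ^ t * M.pairLaw π t s)).hasSum.tendsto_sum_nat.add
    hrem
  simp only [← hsum, add_zero] at hlim
  rw [tendsto_nhds_unique tendsto_const_nhds hlim, occupancy, Measure.sum_apply _ hs]
  refine tsum_congr fun t => ?_
  rw [Measure.smul_apply, M.weight_of_horizon_eq_top h, ENNReal.ofReal_pow M.discount_nonneg,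
    smul_eq_mul]

/-- Every mixture of two occupancy measures is the occupancy measure of a policy. -/
theorem exists_policy_occupancy_eq [StandardBorelSpace A] (M : MOMDP S A n) (π₁ π₂ : M.Policy)
    {a b : ℝ≥0∞} (hab : a + b = 1) :
    ∃ π : M.Policy, M.occupancy π = a • M.occupancy π₁ + b • M.occupancy π₂ := by
  by_cases h : M.horizon = ⊤
  · have hne : Nonempty A := (nonempty_of_isProbabilityMeasure (M.pairLaw π₁ 0)).map Prod.snd
    let ρ : Measure (S × A) := a • M.occupancy π₁ + b • M.occupancy π₂
    have hρ : IsFiniteMeasure ρ := by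
      refine ⟨?_⟩
      simp [ρ, occupancy_univ, ← add_mul, hab]
    let π : M.Policy :=
      { kernel := fun _ => ρ.condKernel
        markov := fun _ => inferInstance
        stationary := fun _ _ => rfl }
    refine ⟨π, (M.eq_occupancy_of_flow h π ρ ?_ (ρ.disintegrate _)).symm⟩
    have hfst : ρ.fst = a • (M.occupancy π₁).fst + b • (M.occupancy π₂).fst := by
      simp [ρ, Measure.fst, Measure.map_add _ _ measurable_fst]
    have hinit : M.init = a • M.init + b • M.init := by rw [← add_smul, hab, one_smul]
    rw [hfst, M.fst_occupancy h, M.fst_occupancy h, Measure.comp_add, Measure.comp_smul,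
      Measure.comp_smul]
    conv_rhs => rw [hinit]
    simp only [smul_add, smul_comm a, smul_comm b]
    abel
  · obtain ⟨π, hπ⟩ := M.exists_policy_pairLaw_eq h π₁ π₂ hab
    refine ⟨π, ?_⟩
    ext s hs
    simp only [occupancy, hπ, Measure.sum_apply _ hs, Measure.add_apply, Measure.smul_apply,
      smul_eq_mul, ← ENNReal.tsum_mul_left, ← ENNReal.tsum_add]
    exact tsum_congr fun t => by ring

/-- For bounded rewards, every convex combination of two return vectors is the return vector of a
policy. -/
theorem exists_policy_expectedReturn_eq [StandardBorelSpace A] (M : MOMDP S A n)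
    (hbdd : ∀ i, ∃ B : ℝ, ∀ x, |M.reward i x| ≤ B) (π₁ π₂ : M.Policy) {a b : ℝ}
    (ha : 0 ≤ a) (hb : 0 ≤ b) (hab : a + b = 1) :
    ∃ π : M.Policy, ∀ i,
      M.expectedReturn i π = a * M.expectedReturn i π₁ + b * M.expectedReturn i π₂ := by
  obtain ⟨π, hπ⟩ := M.exists_policy_occupancy_eq π₁ π₂ (a := ENNReal.ofReal a)
    (b := ENNReal.ofReal b) (by rw [← ENNReal.ofReal_add ha hb, hab, ENNReal.ofReal_one])
  refine ⟨π, fun i => ?_⟩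
  obtain ⟨B, hB⟩ := hbdd i
  have hint (π' : M.Policy) {c : ℝ} :
      Integrable (M.reward i) (ENNReal.ofReal c • M.occupancy π') :=
    (Integrable.of_bound (M.reward_measurable i).aestronglyMeasurable B
      (.of_forall hB)).smul_measure ENNReal.ofReal_ne_top
  simp only [M.expectedReturn_eq_integral_occupancy i hB]
  rw [hπ, integral_add_measure (hint π₁) (hint π₂), integral_smul_measure, integral_smul_measure,
    ENNReal.toReal_ofReal ha, ENNReal.toReal_ofReal hb, smul_eq_mul, smul_eq_mul]

theorem abs_expectedReturn_le (M : MOMDP S A n) (i : Fin n)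
    {B : ℝ} (hB : ∀ x, |M.reward i x| ≤ B) (π : M.Policy) :
    |M.expectedReturn i π| ≤ B * ∑' t, M.weight t := by
  have h := norm_integral_le_of_norm_le_const (f := M.reward i) (μ := M.occupancy π)
    (.of_forall hB)
  rwa [measureReal_def, occupancy_univ,
    ENNReal.toReal_ofReal (tsum_nonneg M.weight_nonneg),
    ← M.expectedReturn_eq_integral_occupancy i hB] at h

end Occupancy

end MOMDP

/-! ### Lagrange multipliers for a convex set of values -/

/-- Existence of Lagrange multipliers: if `V` is a convex set of value vectors, `p` bounds the
coordinate `l` on the part of `V` where `x i > d i` for `i ≠ l`, and this part is nonempty, then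
nonnegative multipliers turn `p` into a bound of the Lagrangian on all of `V`. The multipliers are
the normalised coefficients of a hyperplane that separates `V` from the open orthant of vectors
better than `(p, d)`; the coefficient of the coordinate `l` is positive by Slater's condition. -/
theorem Convex.exists_lagrange_multiplier {ι : Type*} [Fintype ι] [DecidableEq ι]
    {V : Set (ι → ℝ)}
    (hV : Convex ℝ V) (l : ι) (d : {i : ι // i ≠ l} → ℝ) {p : ℝ}
    (hp : ∀ x ∈ V, (∀ i : {i : ι // i ≠ l}, d i < x i) → x l ≤ p)
    (hslater : ∃ x ∈ V, ∀ i : {i : ι // i ≠ l}, d i < x i) :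
    ∃ lam : {i : ι // i ≠ l} → ℝ, 0 ≤ lam ∧
      ∀ x ∈ V, x l - ∑ i : {i : ι // i ≠ l}, lam i * (d i - x i) ≤ p := by
  let q : ι → ℝ := fun i => if h : i ≠ l then d ⟨i, h⟩ else p
  have hql : q l = p := by simp [q]
  have hqd (i : {i : ι // i ≠ l}) : q i = d i := by simp [q, i.2]
  let B : Set (ι → ℝ) := Set.univ.pi fun i => Set.Ioi (q i)
  have hB {x : ι → ℝ} : x ∈ B ↔ ∀ i, q i < x i := by simp [B]
  have hdisj : Disjoint B V := by
    refine Set.disjoint_left.2 fun x hxB hxV => ?_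
    rw [hB] at hxB
    exact (hql ▸ hxB l).not_ge (hp x hxV fun i => hqd i ▸ hxB i)
  obtain ⟨f, u, hfB, hfV⟩ := geometric_hahn_banach_open
    (convex_pi fun i _ => convex_Ioi (q i)) (isOpen_set_pi Set.finite_univ fun i _ => isOpen_Ioi)
    hV hdisj
  have hf (x : ι → ℝ) : f x = ∑ i, x i * f (fun j => if i = j then 1 else 0) :=
    LinearMap.pi_apply_eq_sum_univ f.toLinearMap x
  let c : ι → ℝ := fun i => - f (fun j => if i = j then 1 else 0)
  have hc (i : ι) : 0 ≤ c i := by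
    -- The orthant is unbounded in the direction of the coordinate `i`.
    by_contra! hneg
    have hmem (s : ℝ) (hs : 0 ≤ s) :
        (fun j => q j + 1) + s • (fun j => if i = j then (1 : ℝ) else 0) ∈ B := by
      refine hB.2 fun j => ?_
      simp only [Pi.add_apply, Pi.smul_apply, smul_eq_mul]
      split_ifs <;> linarith
    have h0 := hfB _ (hmem 0 le_rfl)
    have hpos : 0 < f (fun j => if i = j then 1 else 0) := by simpa [c] using hneg
    have h1 := hfB _ (hmem ((u - f fun j => q j + 1) / f (fun j => if i = j then 1 else 0))
      (div_nonneg (by simp at h0; linarith) hpos.le))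
    rw [map_add, map_smul, smul_eq_mul, div_mul_cancel₀ _ hpos.ne'] at h1
    linarith
  have hfq : f q ≤ u := by
    have hcont : Filter.Tendsto (fun ε : ℝ => f (fun j => q j + ε)) (nhdsWithin 0 (Set.Ioi 0))
        (nhds (f q)) := by
      have : Continuous fun ε : ℝ => f (fun j => q j + ε) := by fun_prop
      simpa using (this.tendsto 0).mono_left nhdsWithin_le_nhds
    refine le_of_tendsto hcont ?_
    filter_upwards [self_mem_nhdsWithin] with ε hε
    exact (hfB _ (hB.2 fun j => lt_add_of_pos_right _ hε)).le
  have hmain (x : ι → ℝ) (hx : x ∈ V) :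
      c l * (x l - p) + ∑ i : {i : ι // i ≠ l}, c i * (x i - d i) ≤ 0 := by
    have h1 : ∑ i, c i * (x i - q i) = f q - f x := by
      rw [hf, hf x, ← Finset.sum_sub_distrib]
      exact Finset.sum_congr rfl fun i _ => by simp only [c]; ring
    rw [Fintype.sum_eq_add_sum_subtype_ne _ l, hql] at h1
    simp only [hqd] at h1
    linarith [hfV x hx]
  obtain ⟨x₀, hx₀, hx₀d⟩ := hslater
  have hcl : 0 < c l := by
    refine (hc l).lt_of_ne' fun h0 => ?_
    have h1 := hmain x₀ hx₀
    rw [h0, zero_mul, zero_add] at h1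
    have hterm (i : {i : ι // i ≠ l}) : 0 ≤ c i * (x₀ i - d i) :=
      mul_nonneg (hc i) (sub_nonneg.2 (hx₀d i).le)
    have h2 := (Fintype.sum_eq_zero_iff_of_nonneg hterm).1
      (h1.antisymm (Finset.sum_nonneg fun i _ => hterm i))
    have hc0 (i : ι) : c i = 0 := by
      by_cases hi : i = l
      · rw [hi, h0]
      · exact (mul_eq_zero.1 (congrFun h2 ⟨i, hi⟩)).resolve_right
          (sub_pos.2 (hx₀d ⟨i, hi⟩)).ne'
    have hf0 (x : ι → ℝ) : f x = 0 := by
      rw [hf]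
      exact Finset.sum_eq_zero fun i _ => by rw [neg_eq_zero.1 (hc0 i), mul_zero]
    have h3 := hfB (fun j => q j + 1) (hB.2 fun j => lt_add_one _)
    have h4 := hfV x₀ hx₀
    rw [hf0] at h3 h4
    exact (h3.trans_le h4).false
  refine ⟨fun i => c i / c l, fun i => div_nonneg (hc i) hcl.le, fun x hx => ?_⟩
  have h1 := hmain x hx
  have h2 : ∑ i : {i : ι // i ≠ l}, c i / c l * (d i - x i) =
      - (∑ i : {i : ι // i ≠ l}, c i * (x i - d i)) / c l := by
    rw [neg_div, Finset.sum_div, ← Finset.sum_neg_distrib]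
    exact Finset.sum_congr rfl fun i _ => by ring
  rw [h2, sub_le_iff_le_add, ← sub_le_iff_le_add', le_div_iff₀ hcl]
  linarith

namespace MOMDP

section Duality

variable {S A : Type*} [MeasurableSpace S] [MeasurableSpace A] {n : ℕ}

/-! ### Strong duality -/

theorem primalValue_le_dualFunction (M : MOMDP S A n) (l : Fin n) (d : {i : Fin n // i ≠ l} → ℝ)
    {lam : {i : Fin n // i ≠ l} → ℝ} (hlam : 0 ≤ lam) :
    M.primalValue l d ≤ M.dualFunction l d lam := by
  refine iSup₂_le fun π hπ => le_iSup_of_le π (EReal.coe_le_coe_iff.2 ?_)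
  have : ∑ i : {i : Fin n // i ≠ l}, lam i * (d i - M.expectedReturn i π) ≤ 0 :=
    Finset.sum_nonpos fun i _ => mul_nonpos_of_nonneg_of_nonpos (hlam i) (sub_nonpos.2 (hπ i))
  rw [lagrangian]
  linarith

/-- The value of a constrained problem with a feasible policy is finite, as the returns are
bounded. -/
theorem exists_primalValue_eq_coe (M : MOMDP S A n)
    (hbdd : ∀ i, ∃ B : ℝ, ∀ x, |M.reward i x| ≤ B)
    (l : Fin n) (d : {i : Fin n // i ≠ l} → ℝ) (hslater : M.Slater l d) :
    ∃ p : ℝ, M.primalValue l d = p := by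
  obtain ⟨B, hB⟩ := hbdd l
  obtain ⟨π₀, hπ₀⟩ := hslater
  have hle : M.primalValue l d ≤ ((B * ∑' t, M.weight t : ℝ) : EReal) :=
    iSup₂_le fun π _ => EReal.coe_le_coe_iff.2
      ((le_abs_self _).trans (M.abs_expectedReturn_le l hB π))
  have hge : (M.expectedReturn l π₀ : EReal) ≤ M.primalValue l d :=
    le_iSup₂_of_le π₀ (fun i => (hπ₀ i).le) le_rfl
  exact ⟨_, (EReal.coe_toReal (hle.trans_lt (EReal.coe_lt_top _)).ne
    ((EReal.bot_lt_coe _).trans_le hge).ne').symm⟩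

theorem exists_dualFunction_le_primalValue [StandardBorelSpace A] (M : MOMDP S A n)
    (hbdd : ∀ i, ∃ B : ℝ, ∀ x, |M.reward i x| ≤ B)
    (l : Fin n) (d : {i : Fin n // i ≠ l} → ℝ) (hslater : M.Slater l d) :
    ∃ lam : {i : Fin n // i ≠ l} → ℝ, 0 ≤ lam ∧
      M.dualFunction l d lam ≤ M.primalValue l d := by
  obtain ⟨p, hp⟩ := M.exists_primalValue_eq_coe hbdd l d hslater
  let V : Set (Fin n → ℝ) := Set.range fun (π : M.Policy) i => M.expectedReturn i π
  have hV : Convex ℝ V := by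
    rintro _ ⟨π₁, rfl⟩ _ ⟨π₂, rfl⟩ a b ha hb hab
    obtain ⟨π, hπ⟩ := M.exists_policy_expectedReturn_eq hbdd π₁ π₂ ha hb hab
    exact ⟨π, funext hπ⟩
  obtain ⟨lam, hlam, h⟩ := hV.exists_lagrange_multiplier l d (p := p)
    (by
      rintro _ ⟨π, rfl⟩ hπ
      rw [← EReal.coe_le_coe_iff, ← hp]
      exact le_iSup₂_of_le π (fun i => (hπ i).le) le_rfl)
    (by
      obtain ⟨π₀, hπ₀⟩ := hslater
      exact ⟨_, ⟨π₀, rfl⟩, hπ₀⟩)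
  refine ⟨lam, hlam, iSup_le fun π => ?_⟩
  rw [hp, EReal.coe_le_coe_iff]
  exact h _ ⟨π, rfl⟩

/-! ### The log-barrier problem -/

/-- Moving an approximate solution `π` of the barrier problem a fraction `θ` of the way towards a
feasible policy `π'` shrinks each slack by a factor of at least `1 - θ`, and `log (1 - θ)` is at
least `-θ / (1 - θ)`. -/
theorem IsBarrierSolution.expectedReturn_le [StandardBorelSpace A] {M : MOMDP S A n}
    (hbdd : ∀ i, ∃ B : ℝ, ∀ x, |M.reward i x| ≤ B) {l : Fin n} {β : ℝ} {πr π π' : M.Policy}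
    {t ε θ : ℝ} (ht : 0 < t) (hπ : M.IsBarrierSolution l β πr t ε π)
    (hπ' : M.Feasible l (fun i => β * M.expectedReturn i πr) π') (hθ : 0 < θ) (hθ1 : θ < 1) :
    M.expectedReturn l π' ≤
      M.expectedReturn l π + ((n : ℝ) - 1) / t * (1 - θ)⁻¹ + ε / θ := by
  obtain ⟨π'', hmix⟩ := M.exists_policy_expectedReturn_eq hbdd π π' (a := 1 - θ) (b := θ)
    (by linarith) hθ.le (by ring)
  have h1θ : 0 < 1 - θ := by linarith
  have hslack (i : {i : Fin n // i ≠ l}) :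
      (1 - θ) * (M.expectedReturn i π - β * M.expectedReturn i πr) ≤
        M.expectedReturn i π'' - β * M.expectedReturn i πr := by
    rw [hmix]
    have := mul_nonneg hθ.le (sub_nonneg.2 (hπ' i))
    linarith
  have hpos (i : {i : Fin n // i ≠ l}) :
      0 < M.expectedReturn i π - β * M.expectedReturn i πr := sub_pos.2 (hπ.1 i)
  have hbar := hπ.2 π'' fun i => sub_pos.1 ((mul_pos h1θ (hpos i)).trans_le (hslack i))
  have hlog : ∑ i : {i : Fin n // i ≠ l},
        (Real.log (M.expectedReturn i π - β * M.expectedReturn i πr) / t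
          - θ * (1 - θ)⁻¹ / t) ≤
      ∑ i : {i : Fin n // i ≠ l},
        Real.log (M.expectedReturn i π'' - β * M.expectedReturn i πr) / t := by
    refine Finset.sum_le_sum fun i _ => ?_
    rw [← sub_div]
    refine div_le_div_of_nonneg_right ?_ ht.le
    have h1 := Real.log_le_log (mul_pos h1θ (hpos i)) (hslack i)
    rw [Real.log_mul h1θ.ne' (hpos i).ne'] at h1
    have h2 := Real.one_sub_inv_le_log_of_pos h1θ
    have h3 : θ * (1 - θ)⁻¹ = (1 - θ)⁻¹ - 1 := by field_simp; ring
    linarith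
  have hcard : (Fintype.card {i : Fin n // i ≠ l} : ℝ) = n - 1 := by
    rw [Fintype.card_subtype_compl, Fintype.card_fin, Fintype.card_unique,
      Nat.cast_pred (Fin.pos l)]
  rw [Finset.sum_sub_distrib, Finset.sum_const, Finset.card_univ, nsmul_eq_mul, hcard] at hlog
  rw [barrierObjective, barrierObjective, hmix] at hbar
  have hfin : θ * M.expectedReturn l π' ≤
      θ * (M.expectedReturn l π + ((n : ℝ) - 1) / t * (1 - θ)⁻¹ + ε / θ) := by
    have e1 : θ * (ε / θ) = ε := by field_simp
    have e2 : θ * (((n : ℝ) - 1) / t * (1 - θ)⁻¹) = (n - 1) * (θ * (1 - θ)⁻¹ / t) := by ring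
    rw [mul_add, mul_add, e1, e2]
    linarith
  exact le_of_mul_le_mul_left hfin hθ

/-- The duality gap of approximate solutions of the barrier problem is at most `(n - 1) / t`, up to
an error that tends to zero with the tolerance. -/
theorem exists_pos_forall_isBarrierSolution_expectedReturn_le [StandardBorelSpace A]
    (M : MOMDP S A n) (hbdd : ∀ i, ∃ B : ℝ, ∀ x, |M.reward i x| ≤ B) (l : Fin n) (β : ℝ)
    (πr : M.Policy) {t η : ℝ} (ht : 0 < t) (hη : 0 < η) :
    ∃ ε : ℝ, 0 < ε ∧ ∀ π π' : M.Policy, M.IsBarrierSolution l β πr t ε π →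
      M.Feasible l (fun i => β * M.expectedReturn i πr) π' →
      M.expectedReturn l π' ≤ M.expectedReturn l π + (((n : ℝ) - 1) / t + η) := by
  set c : ℝ := ((n : ℝ) - 1) / t with hc
  have hc0 : 0 ≤ c := by
    have : (1 : ℝ) ≤ n := by exact_mod_cast Fin.pos l
    exact div_nonneg (by linarith) ht.le
  -- With this step size `c * (1 - θ)⁻¹ = c + c * η / (2 * c + 1) ≤ c + η / 2`.
  let θ : ℝ := η / (η + 2 * c + 1)
  have hden : 0 < η + 2 * c + 1 := by positivity
  have hθ : 0 < θ := by positivity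
  have hθ1 : θ < 1 := by rw [div_lt_one hden]; linarith
  have hinv : (1 - θ)⁻¹ = 1 + η / (2 * c + 1) := by
    have h1 : 1 - θ = (2 * c + 1) / (η + 2 * c + 1) := by simp only [θ]; field_simp; ring
    rw [h1, inv_div]
    field_simp
    ring
  have hbound : c * (1 - θ)⁻¹ ≤ c + η / 2 := by
    have : c * (η / (2 * c + 1)) ≤ η / 2 := by
      rw [mul_div_assoc', div_le_div_iff₀ (by positivity) two_pos]
      nlinarith
    rw [hinv]
    linarith
  refine ⟨θ * (η / 2), by positivity, fun π π' hπ hπ' => ?_⟩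
  have h := hπ.expectedReturn_le hbdd ht hπ' hθ hθ1
  rw [mul_div_cancel_left₀ _ hθ.ne', ← hc] at h
  linarith

theorem primalValue_sub_le (M : MOMDP S A n) {l : Fin n} {d : {i : Fin n // i ≠ l} → ℝ}
    {x c : ℝ} (h : ∀ π : M.Policy, M.Feasible l d π → M.expectedReturn l π ≤ x + c) :
    M.primalValue l d - (x : EReal) ≤ (c : EReal) :=
  EReal.sub_le_of_le_add' <| iSup₂_le fun π hπ => by
    rw [← EReal.coe_add]
    exact EReal.coe_le_coe_iff.2 (h π hπ)

end Duality

end MOMDP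

theorem mainTheorem1 {S A : Type*} [MeasurableSpace S] [MeasurableSpace A] [StandardBorelSpace A]
    {n : ℕ} (M : MOMDP S A n)
    (hbdd : ∀ i, ∃ B : ℝ, ∀ x, |M.reward i x| ≤ B)
    (l : Fin n) (d : {i : Fin n // i ≠ l} → ℝ) (hslater : M.Slater l d) :
    (M.primalValue l d = M.dualValue l d ∧
      ∃ lam : {i : Fin n // i ≠ l} → ℝ, 0 ≤ lam ∧ M.dualFunction l d lam = M.dualValue l d) ∧
    ∀ (β : ℝ) (πr : M.Policy), (∀ i : {i : Fin n // i ≠ l}, d i = β * M.expectedReturn i πr) →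
      ∀ t : ℝ, 0 < t →
        (∀ π : M.Policy, M.IsBarrierSolution l β πr t 0 π →
          M.Feasible l d π ∧
          M.primalValue l d - (M.expectedReturn l π : EReal) ≤ ((((n : ℝ) - 1) / t : ℝ) : EReal)) ∧
        (∀ η : ℝ, 0 < η → ∃ ε : ℝ, 0 < ε ∧
          ∀ π : M.Policy, M.IsBarrierSolution l β πr t ε π →
            M.primalValue l d - (M.expectedReturn l π : EReal) ≤
              ((((n : ℝ) - 1) / t + η : ℝ) : EReal)) := by
  refine ⟨?_, fun β πr hd t ht => ?_⟩
  · have hweak : M.primalValue l d ≤ M.dualValue l d :=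
      le_iInf₂ fun lam hlam => M.primalValue_le_dualFunction l d hlam
    obtain ⟨lam, hlam, hle⟩ := M.exists_dualFunction_le_primalValue hbdd l d hslater
    have hge : M.dualValue l d ≤ M.dualFunction l d lam := iInf₂_le lam hlam
    exact ⟨hweak.antisymm (hge.trans hle), lam, hlam, (hle.trans hweak).antisymm hge⟩
  · obtain rfl : d = fun i : {i : Fin n // i ≠ l} => β * M.expectedReturn i πr := funext hd
    refine ⟨fun π hπ => ⟨fun i => (hπ.1 i).le, M.primalValue_sub_le fun π' hπ' => ?_⟩,
      fun η hη => ?_⟩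
    · refine le_of_forall_pos_le_add fun η hη => ?_
      obtain ⟨ε, hε, h⟩ :=
        M.exists_pos_forall_isBarrierSolution_expectedReturn_le hbdd l β πr ht hη
      rw [add_assoc]
      -- An exact maximiser is an approximate one for every tolerance.
      exact h π π' ⟨hπ.1, fun π₂ hπ₂ => (hπ.2 π₂ hπ₂).trans (by linarith)⟩ hπ'
    · obtain ⟨ε, hε, h⟩ :=
        M.exists_pos_forall_isBarrierSolution_expectedReturn_le hbdd l β πr ht hη
      exact ⟨ε, hε, fun π hπ => M.primalValue_sub_le fun π' hπ' => h π π' hπ hπ'⟩
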